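/- Let $x_1,\dots,x_n$ be freely noncommuting self-adjoint variables, $\mathscr S=\mathbb C[\varsigma(w): w\ne 1\text{ a word in }x_1,\dots,x_n]$ the commutative $*$-algebra of state polynomials (with conjugate-linear involution $\varsigma(w)^*=\varsigma(w^*)$), and $\mathscr S\langle \underline x\rangle=\mathscr S\otimes_{\mathbb C}\mathbb C\langle \underline x\rangle$ the $*$-algebra of noncommutative state polynomials, where $x_j^*=x_j$; let $\varsigma:\mathscr S\langle\underline x\rangle\to\mathscr S$ be the $\mathscr S$-linear unital map with $w\mapsto\varsigma(w)$. Let $C\subset\mathscr S\langle\underline x\rangle$ be a (possibly infinite) set of self-adjoint elements that is archimedean: there is $N>0$ such that $N-x_1^2-\cdots-x_n^2$ is a finite sum $\sum_j g_j^*c_jg_j$ with $g_j\in\mathscr S\langle\underline x\rangle$ and $c_j\in\{1\}\cup C$. Let $\mathcal H=\ell^2(\mathbb N)$, and let $\mathcal D^\infty(C)$ be the set of pairs $(\lambda,\underline X)$ of a state (positive unital linear functional) $\lambda$ on $\mathcal B(\mathcal H)$ and an $n$-tuple $\underline X$ of self-adjoint operators in $\mathcal B(\mathcal H)$ such that $c(\lambda,\underline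 X)\succeq 0$ for all $c\in C$, where evaluation replaces $x_j$ by $X_j$ and $\varsigma$ by $\lambda$. For $d\in\mathbb N$ let $$\operatorname{QM}(C)_d=\Big\{\sum_j\varsigma(g_j^*c_jg_j)\ (\text{finite sum}):\ g_j\in\mathscr S\langle\underline x\rangle,\ c_j\in\{1\}\cup C,\ \deg(g_j^*c_jg_j)\le 2d\Big\},$$ where $\deg$ is the total degree in $x_1,\dots,x_n$, counting occurrences both outside and inside of $\varsigma$. For a self-adjoint state polynomial $f=f^*\in\mathscr S$ put $$\alpha_*=\inf\{f(\lambda,\underline X):(\lambda,\underline X)\in\mathcal D^\infty(C)\},\qquad \alpha_d=\sup\{\alpha\in\mathbb R: f-\alpha\in\operatorname{QM}(C)_d\},$$ in $[-\infty,\infty]$, with $\inf\emptyset=+\infty$ and $\sup\emptyset=-\infty$. Then $(\alpha_d)_{d}$ is an increasing (that is, nondecreasing) sequence that converges to $\alpha_*$ in $[-\infty,\infty]$, and $\alpha_*$ is a real number whenever $\mathcal D^\infty(C)\neq\emptyset$. -/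

import Mathlib

open scoped ComplexOrder

noncomputable section

/-- Words in the freely noncommuting self-adjoint variables `x_1, ..., x_n`; the involution `star`
on words (from Mathlib) is reversal. -/
abbrev Word (n : ℕ) : Type := FreeMonoid (Fin n)

/-- The algebra `𝒮` of state polynomials: the commutative polynomial algebra over `ℂ` in the
indeterminates `ς(w)`, one for every word `w ≠ 1`. -/
abbrev StatePoly (n : ℕ) : Type := MvPolynomial {w : Word n // w ≠ 1} ℂ

/-- The algebra `𝒮⟨x⟩ = 𝒮 ⊗ ℂ⟨x⟩` of noncommutative state polynomials, realized as the monoid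
algebra of the free monoid of words with coefficients in `𝒮`. -/
abbrev NCStatePoly (n : ℕ) : Type := MonoidAlgebra (StatePoly n) (Word n)

namespace StatePoly

variable {n : ℕ}

/-- The formal state symbol on words, with `ς(1) = 1`. -/
def sigmaWord (w : Word n) : StatePoly n :=
  open Classical in if h : w = 1 then 1 else MvPolynomial.X ⟨w, h⟩

/-- Reversal of nonempty words. -/
def starWord (w : {w : Word n // w ≠ 1}) : {w : Word n // w ≠ 1} :=
  ⟨star w.1, fun h => w.2 (star_injective (h.trans (star_one _).symm))⟩

/-- The conjugate-linear ring endomorphism of `𝒮` with `ς(w) ↦ ς(w^*)`. -/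
def starHom (n : ℕ) : StatePoly n →+* StatePoly n :=
  MvPolynomial.eval₂Hom (MvPolynomial.C.comp (starRingEnd ℂ))
    (fun w => MvPolynomial.X (starWord w))

theorem starHom_C (a : ℂ) :
    starHom n (MvPolynomial.C a) = MvPolynomial.C ((starRingEnd ℂ) a) := by
  simp [starHom]

theorem starHom_X (w : {w : Word n // w ≠ 1}) :
    starHom n (MvPolynomial.X w) = MvPolynomial.X (starWord w) := by
  simp [starHom]

theorem starHom_starHom (p : StatePoly n) : starHom n (starHom n p) = p := by
  induction p using MvPolynomial.induction_on with
  | C a => simp [starHom_C]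
  | add p q hp hq => simp [hp, hq]
  | mul_X p w hp => simp [hp, starHom_X, starWord]

/-- The conjugate-linear involution on state polynomials, determined by `ς(w)^* = ς(w^*)`. -/
instance instStarRing : StarRing (StatePoly n) where
  star := starHom n
  star_involutive := starHom_starHom
  star_mul p q := by rw [map_mul, mul_comm]
  star_add p q := map_add _ p q

theorem star_def (p : StatePoly n) : star p = starHom n p := rfl

end StatePoly

namespace NCStatePoly

variable {n : ℕ}

/-- The involution as an additive map: `(∑ s_w w)^* = ∑ s_w^* w^*`. -/
def starAddHom (n : ℕ) : NCStatePoly n →+ NCStatePoly n where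
  toFun f := f.coeff.sum fun w s => MonoidAlgebra.single (star w) (star s)
  map_zero' := by simp
  map_add' f g := by
    rw [MonoidAlgebra.coeff_add]
    exact Finsupp.sum_add_index' (by simp) (by simp)

theorem starAddHom_single (w : Word n) (s : StatePoly n) :
    starAddHom n (MonoidAlgebra.single w s) = MonoidAlgebra.single (star w) (star s) := by
  have h : (MonoidAlgebra.single (star w) (star 0) : NCStatePoly n) = 0 := by
    rw [star_zero, MonoidAlgebra.single_zero]
  exact Finsupp.sum_single_index (h := fun w s => MonoidAlgebra.single (star w) (star s)) h

/-- The conjugate-linear involution on noncommutative state polynomials, which fixes every `x_j`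
and extends that on `𝒮`. -/
instance instStarRing : StarRing (NCStatePoly n) where
  star := starAddHom n
  star_involutive f := by
    have : (starAddHom n).comp (starAddHom n) = AddMonoidHom.id _ := by
      refine MonoidAlgebra.addMonoidHom_ext fun w s => ?_
      simp [starAddHom_single]
    exact DFunLike.congr_fun this f
  star_mul f g := by
    induction f using MonoidAlgebra.induction_linear with
    | zero => simp
    | add f₁ f₂ h₁ h₂ => rw [add_mul, map_add, h₁, h₂, map_add, mul_add]
    | single w s =>
      induction g using MonoidAlgebra.induction_linear with
      | zero => simp
      | add g₁ g₂ h₁ h₂ => rw [mul_add, map_add, h₁, h₂, map_add, add_mul]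
      | single v t =>
        simp only [MonoidAlgebra.single_mul_single, starAddHom_single, star_mul]
  star_add f g := map_add _ f g

theorem star_single (w : Word n) (s : StatePoly n) :
    star (MonoidAlgebra.single w s : NCStatePoly n) = MonoidAlgebra.single (star w) (star s) :=
  starAddHom_single w s

/-- The variable `x_j`. -/
def x (j : Fin n) : NCStatePoly n := MonoidAlgebra.single (FreeMonoid.of j) 1

/-- The `𝒮`-linear unital map `ς : 𝒮⟨x⟩ → 𝒮` with `w ↦ ς(w)` on words. -/
def sigma (f : NCStatePoly n) : StatePoly n :=
  f.coeff.sum fun w s => s * StatePoly.sigmaWord w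

/-- The total degree of a noncommutative state polynomial in `x_1, ..., x_n`, counting the
occurrences of the variables both outside and inside of the state symbol: `ς(v)` has degree
the length of `v`. (The zero polynomial gets degree `0`.) -/
def degree (f : NCStatePoly n) : ℕ :=
  f.coeff.support.sup fun w =>
    MvPolynomial.weightedTotalDegree (fun v : {v : Word n // v ≠ 1} => v.1.length) (f.coeff w)
      + w.length

end NCStatePoly

/-- The separable infinite-dimensional Hilbert space `ℓ²(ℕ)`. -/
abbrev HilbertL2 : Type := lp (fun _ : ℕ => ℂ) 2

/-- The algebra `B(ℓ²(ℕ))` of bounded operators. -/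
abbrev BoundedOp : Type := HilbertL2 →L[ℂ] HilbertL2

/-- A state on `B(ℓ²(ℕ))`: a positive unital linear functional. Here `0 ≤ z` for complex `z` means
that `z` is real and nonnegative. -/
structure OpState where
  toLinearMap : BoundedOp →ₗ[ℂ] ℂ
  nonneg : ∀ A : BoundedOp, A.IsPositive → 0 ≤ toLinearMap A
  unital : toLinearMap 1 = 1

section evaluation

variable {n : ℕ}

/-- The value `w(X)` of a word at a tuple of operators. -/
def evalWord (X : Fin n → BoundedOp) (w : Word n) : BoundedOp := FreeMonoid.lift X w

/-- The state evaluation `f(lam, X) ∈ ℂ` of a state polynomial: `ς(w)` is replaced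
by `lam (w(X))`. -/
def StatePoly.eval (lam : OpState) (X : Fin n → BoundedOp) (f : StatePoly n) : ℂ :=
  MvPolynomial.aeval (fun w : {w : Word n // w ≠ 1} => lam.toLinearMap (evalWord X w.1)) f

/-- The state evaluation `f(lam, X) ∈ B(H)` of a noncommutative state polynomial. -/
def NCStatePoly.eval (lam : OpState) (X : Fin n → BoundedOp) (f : NCStatePoly n) : BoundedOp :=
  f.coeff.sum fun w s => StatePoly.eval lam X s • evalWord X w

/-- The state semialgebraic set `𝒟^∞(C)`. -/
def stateDomain (C : Set (NCStatePoly n)) : Set (OpState × (Fin n → BoundedOp)) :=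
  {p | (∀ j, IsSelfAdjoint (p.2 j)) ∧ ∀ c ∈ C, (NCStatePoly.eval p.1 p.2 c).IsPositive}

/-- The constraint set `C` is archimedean: for some `N > 0`,
`N - x_1^2 - ... - x_n^2 = ∑ f_j^* c_j f_j` (a finite sum) with all `c_j ∈ {1} ∪ C`. -/
def IsArchimedeanConstraintSet (C : Set (NCStatePoly n)) : Prop :=
  ∃ N : ℝ, 0 < N ∧ ∃ (m : ℕ) (g c : Fin m → NCStatePoly n), (∀ j, c j ∈ insert 1 C) ∧
    algebraMap ℂ (NCStatePoly n) (N : ℂ) - ∑ i, NCStatePoly.x i ^ 2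
      = ∑ j, star (g j) * c j * g j

/-- The truncated state quadratic module `QM(C)_d`: the finite sums of `ς(f_j^* c_j f_j)`
with `c_j ∈ {1} ∪ C` and `deg (f_j^* c_j f_j) ≤ 2d`. -/
def truncatedQM (C : Set (NCStatePoly n)) (d : ℕ) : Set (StatePoly n) :=
  {q | ∃ (m : ℕ) (g c : Fin m → NCStatePoly n), (∀ j, c j ∈ insert 1 C) ∧
    (∀ j, NCStatePoly.degree (star (g j) * c j * g j) ≤ 2 * d) ∧
    q = ∑ j, NCStatePoly.sigma (star (g j) * c j * g j)}

/-- The bound `α_d = sup {α ∈ ℝ : f - α ∈ QM(C)_d}`, in the extended real line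
(so it is `-∞` if there is no such `α`). -/
def sosBound (C : Set (NCStatePoly n)) (f : StatePoly n) (d : ℕ) : EReal :=
  sSup (Real.toEReal '' {α : ℝ | f - MvPolynomial.C (α : ℂ) ∈ truncatedQM C d})

/-- The infimum `α_*` of `f` over `𝒟^∞(C)`, in the extended real line (so it is `+∞` if `𝒟^∞(C)` is
empty). For self-adjoint `f` the values `f(lam, X)` at points of `𝒟^∞(C)` are real. -/
def stateInf (C : Set (NCStatePoly n)) (f : StatePoly n) : EReal :=
  ⨅ p ∈ stateDomain C, ((StatePoly.eval p.1 p.2 f).re : EReal)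

theorem OpState.map_star (lam : OpState) (A : BoundedOp) :
    lam.toLinearMap (star A) = (starRingEnd ℂ) (lam.toLinearMap A) := by
  have hsa : ∀ B : BoundedOp, IsSelfAdjoint B → (lam.toLinearMap B).im = 0 := by
    intro B hB
    have hp : ((algebraMap ℝ BoundedOp ‖B‖) - B).IsPositive := by
      rw [← ContinuousLinearMap.nonneg_iff_isPositive, sub_nonneg]
      exact hB.le_algebraMap_norm_self
    have h1 : (lam.toLinearMap (algebraMap ℝ BoundedOp ‖B‖)) = (‖B‖ : ℂ) := by
      have : algebraMap ℝ BoundedOp ‖B‖ = (‖B‖ : ℂ) • (1 : BoundedOp) := by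
        rw [Algebra.algebraMap_eq_smul_one]
        exact (Complex.coe_smul _ _).symm
      rw [this, map_smul, lam.unital, smul_eq_mul, mul_one]
    have h2 := (Complex.nonneg_iff.mp (lam.nonneg _ hp)).2
    rw [map_sub, h1, Complex.sub_im, Complex.ofReal_im] at h2
    linarith
  have hA : A = (realPart A : BoundedOp) + Complex.I • (imaginaryPart A : BoundedOp) :=
    (realPart_add_I_smul_imaginaryPart A).symm
  have hs : star A = (realPart A : BoundedOp) - Complex.I • (imaginaryPart A : BoundedOp) := by
    conv_lhs => rw [hA]
    rw [star_add, star_smul, (realPart A).2.star_eq, (imaginaryPart A).2.star_eq]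
    simp [sub_eq_add_neg]
  have hr := hsa _ (realPart A).2
  have hi := hsa _ (imaginaryPart A).2
  rw [hs]
  conv_rhs => rw [hA]
  simp only [map_sub, map_add, map_smul, smul_eq_mul, map_mul, Complex.conj_I]
  rw [Complex.conj_eq_iff_im.mpr hr, Complex.conj_eq_iff_im.mpr hi]
  ring

theorem evalWord_star {X : Fin n → BoundedOp} (hX : ∀ j, IsSelfAdjoint (X j)) (w : Word n) :
    evalWord X (star w) = star (evalWord X w) := by
  induction w using FreeMonoid.inductionOn' with
  | one => simp [evalWord]
  | of_mul j w ih =>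
    simp only [evalWord, star_mul, map_mul, FreeMonoid.star_of, FreeMonoid.lift_eval_of] at ih ⊢
    rw [ih, (hX j).star_eq]

theorem StatePoly.eval_star (lam : OpState) {X : Fin n → BoundedOp}
    (hX : ∀ j, IsSelfAdjoint (X j)) (f : StatePoly n) :
    StatePoly.eval lam X (star f) = (starRingEnd ℂ) (StatePoly.eval lam X f) := by
  rw [StatePoly.star_def]
  induction f using MvPolynomial.induction_on with
  | C a => simp [StatePoly.eval, StatePoly.starHom_C]
  | add p q hp hq =>
    simp only [StatePoly.eval, map_add] at hp hq ⊢
    rw [hp, hq]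
  | mul_X p w hp =>
    simp only [StatePoly.eval, map_mul, StatePoly.starHom_X, MvPolynomial.aeval_X] at hp ⊢
    rw [hp, StatePoly.starWord, evalWord_star hX, lam.map_star]

/-- Self-adjoint state polynomials have real values, so that taking the real part in the
definition of the infimum loses nothing. -/
theorem StatePoly.eval_im_eq_zero (lam : OpState) {X : Fin n → BoundedOp}
    (hX : ∀ j, IsSelfAdjoint (X j)) {f : StatePoly n} (hf : IsSelfAdjoint f) :
    (StatePoly.eval lam X f).im = 0 := by
  rw [← Complex.conj_eq_iff_im, ← StatePoly.eval_star lam hX, hf.star_eq]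

end evaluation

end

/-! Soundness is direct: at a point of `stateDomain C` each ς(g^*cg) becomes the state of a
conjugate of a positive operator, so f - α ∈ QM(C) forces α ≤ α_*. Since QM(C) is the union of its
truncations, convergence reduces to a Positivstellensatz (`sub_mem_of_lt_stateInf`): α < α_* implies
f - α ∈ QM(C).

QM(C) is archimedean in the commutative algebra 𝒮 (`exists_sub_mem_stateQuadraticModule`): bounds on
the x_j pass to words, through ς by Cauchy–Schwarz, and on to polynomials in the ς(w). If f - α ∉
QM(C), then `exists_character_nonpos` gives a *-character φ of 𝒮 that is nonnegative on QM(C) and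
nonpositive at f - α: normalized positive functionals form a compact convex set, and its extreme
points are multiplicative.

A GNS construction (`exists_mem_stateDomain_of_character`) turns φ into a point of the domain. On
𝒮⟨x⟩ take the form φ(ς(p^*q)), with x_j acting by left multiplication; multiplicativity of φ makes
coefficients act as scalars, and the class of 1 gives the state. Countably many copies of this space
ensure that its completion is ℓ²(ℕ). At that point f ≤ α, contradicting α < α_*. -/

noncomputable section

/-! ### Characters separating points from archimedean quadratic modules -/

section ArchimedeanModules

variable {S : Type*} [CommRing S] [StarRing S] [Algebra ℂ S]

/-- Archimedean quadratic modules in a commutative complex `*`-algebra: sets of self-adjoint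
elements that contain `1`, are closed under addition and under multiplication by all `t^* t`, and
for which every `a^* a` is bounded by a real scalar. -/
structure IsArchimedeanQuadraticModule (M : Set S) : Prop where
  one_mem : 1 ∈ M
  add_mem : ∀ {a b}, a ∈ M → b ∈ M → a + b ∈ M
  conj_mem : ∀ (t : S) {a}, a ∈ M → star t * t * a ∈ M
  isSelfAdjoint : ∀ {a}, a ∈ M → IsSelfAdjoint a
  arch : ∀ a : S, ∃ R : ℝ, (R : ℂ) • (1 : S) - star a * a ∈ M

/-- The real linear functionals `L` with `L 1 = 1` that are nonnegative on all elements
whose real part is in `M`. -/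
def moduleStates (M : Set S) : Set (S → ℝ) :=
  {L | L 1 = 1 ∧ (∀ a b, L (a + b) = L a + L b) ∧ (∀ (r : ℝ) a, L (r • a) = r * L a) ∧
    ∀ a, a + star a ∈ M → 0 ≤ L a}

/-- A log-convex nonnegative sequence of growth at most `N ^ k` satisfies `a 1 ≤ N * a 0`. -/
theorem le_mul_of_logConvex_of_growth {a : ℕ → ℝ} {N R : ℝ} (hN : 0 < N) (h0 : ∀ k, 0 ≤ a k)
    (hconv : ∀ k, a (k + 1) ^ 2 ≤ a k * a (k + 2)) (hgrowth : ∀ k, a k ≤ R * N ^ k) :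
    a 1 ≤ N * a 0 := by
  by_contra! hlt
  have ha0 : 0 < a 0 := by
    refine (h0 0).lt_of_ne' fun h => ?_
    have := hconv 0
    rw [h, zero_mul] at this
    have h1 : a 1 = 0 := by simpa using le_antisymm this (sq_nonneg _)
    rw [h, h1] at hlt
    simp at hlt
  -- Log-convexity makes the successive ratios nondecreasing, so all are at least r > N, and a k ≥ r
  -- ^ k * a 0 eventually exceeds R * N ^ k.
  set r := a 1 / a 0 with hr
  have hrN : N < r := by rwa [hr, lt_div_iff₀ ha0]
  have hr0 : 0 < r := hN.trans hrN
  have hstep : ∀ k, 0 < a k ∧ r * a k ≤ a (k + 1) := by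
    intro k
    induction k with
    | zero => exact ⟨ha0, by rw [hr, div_mul_cancel₀ _ ha0.ne']⟩
    | succ k ih =>
      obtain ⟨hk, hk1⟩ := ih
      have hpos : 0 < a (k + 1) := (mul_pos hr0 hk).trans_le hk1
      refine ⟨hpos, ?_⟩
      have h1 : r * a k * a (k + 1) ≤ a k * a (k + 2) :=
        (mul_le_mul_of_nonneg_right hk1 hpos.le).trans (by rw [← sq]; exact hconv k)
      have h2 : a k * (r * a (k + 1)) ≤ a k * a (k + 2) := by linarith
      exact le_of_mul_le_mul_left h2 hk
  have hpow : ∀ k, r ^ k * a 0 ≤ a k := by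
    intro k
    induction k with
    | zero => simp
    | succ k ih =>
      calc r ^ (k + 1) * a 0 = r * (r ^ k * a 0) := by ring
        _ ≤ r * a k := mul_le_mul_of_nonneg_left ih hr0.le
        _ ≤ a (k + 1) := (hstep k).2
  obtain ⟨k, hk⟩ := pow_unbounded_of_one_lt (R / a 0) ((one_lt_div hN).2 hrN)
  rw [div_pow, div_lt_div_iff₀ ha0 (pow_pos hN k)] at hk
  linarith [hpow k, hgrowth k]

namespace IsArchimedeanQuadraticModule

variable {M : Set S} (hM : IsArchimedeanQuadraticModule M)
include hM

theorem zero_mem : (0 : S) ∈ M := by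
  simpa using hM.conj_mem 0 hM.one_mem

variable [StarModule ℂ S]

theorem smul_mem {r : ℝ} (hr : 0 ≤ r) {a : S} (ha : a ∈ M) : r • a ∈ M := by
  have h := hM.conj_mem (Real.sqrt r • (1 : S)) ha
  simpa [star_smul, smul_smul, Real.mul_self_sqrt hr] using h

omit [StarModule ℂ S] in
theorem sum_star_mem {a : S} (ha : a ∈ M) : a + star a ∈ M := by
  rw [(hM.isSelfAdjoint ha).star_eq]
  exact hM.add_mem ha ha

/-- (a + 1)^*(a + 1) + (R - a^*a) = (R + 1) + a + a^*. Thus 1 is an order unit, which is what Riesz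
extension and compactness of the state space need. -/
theorem exists_real_add_mem (a : S) : ∃ R : ℝ, R • (1 : S) + a + star (R • (1 : S) + a) ∈ M := by
  obtain ⟨R, hR⟩ := hM.arch a
  rw [Complex.coe_smul] at hR
  refine ⟨(R + 1) / 2, ?_⟩
  have h1 := hM.conj_mem (a + 1) hM.one_mem
  convert hM.add_mem h1 hR using 1
  simp only [star_add, star_smul, star_one, star_trivial, mul_one]
  have : R • (1 : S) + 1 = ((R + 1) / 2) • (1 : S) + ((R + 1) / 2) • (1 : S) := by
    rw [← add_smul, add_halves, add_smul, one_smul]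
  linear_combination -this

theorem mem_of_neg_one_mem (h : (-1 : S) ∈ M) {a : S} (ha : IsSelfAdjoint a) : a ∈ M := by
  -- 4a = (a + 1)² - (a - 1)².
  have hq : (1 / 4 : ℝ) • (4 * a) = a := by
    rw [show (4 : S) * a = a + a + a + a by ring]
    module
  rw [← hq]
  apply hM.smul_mem (by norm_num)
  have h1 := hM.conj_mem (a + 1) hM.one_mem
  have h2 := hM.conj_mem (a - 1) h
  convert hM.add_mem h1 h2 using 1
  simp only [star_add, star_sub, star_one, ha.star_eq]
  ring

/-- Riesz extension of r·1 ↦ r, with the cone of elements of real part in M enlarged by -a, so that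
the extension must be nonpositive at a. -/
theorem exists_state_nonpos {a : S} (ha : IsSelfAdjoint a) (haM : a ∉ M) :
    ∃ L ∈ moduleStates M, L a ≤ 0 := by
  have hone : (1 : S) ≠ 0 := by
    intro h
    apply haM
    rw [← one_mul a, h, zero_mul]
    exact hM.zero_mem
  let P : PointedCone ℝ S :=
    { carrier := {s | ∃ t : ℝ, 0 ≤ t ∧ s + t • a + star (s + t • a) ∈ M}
      add_mem' := by
        rintro s s' ⟨t, ht, h⟩ ⟨t', ht', h'⟩
        refine ⟨t + t', add_nonneg ht ht', ?_⟩
        convert hM.add_mem h h' using 1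
        simp only [star_add, add_smul]
        ring
      zero_mem' := ⟨0, le_rfl, by simpa using hM.zero_mem⟩
      smul_mem' := by
        rintro ⟨r, hr⟩ s ⟨t, ht, h⟩
        refine ⟨r * t, mul_nonneg hr ht, ?_⟩
        convert hM.smul_mem hr h using 1
        simp only [star_add, smul_add, star_smul, star_trivial, mul_smul, Nonneg.mk_smul] }
  let f : S →ₗ.[ℝ] ℝ := LinearPMap.mkSpanSingleton (1 : S) (1 : ℝ) hone
  have hfdom : ∀ x : f.domain, ∃ r : ℝ, (x : S) = r • (1 : S) ∧ f x = r := by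
    rintro ⟨x, hx⟩
    obtain ⟨r, rfl⟩ := Submodule.mem_span_singleton.1 hx
    refine ⟨r, rfl, ?_⟩
    have := LinearPMap.mkSpanSingleton'_apply (σ := RingHom.id ℝ) (1 : S) (1 : ℝ)
      (fun c hc => by
        rcases smul_eq_zero.1 hc with h | h
        · simp [h]
        · exact absurd h hone) r hx
    exact this.trans (by simp)
  have hmem1 : ∀ r : ℝ, r • (1 : S) ∈ f.domain := fun r =>
    Submodule.smul_mem _ _ (Submodule.mem_span_singleton_self _)
  obtain ⟨g, hg, hgP⟩ := riesz_extension P f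
    (by
      intro x hx
      obtain ⟨r, hxr, hfr⟩ := hfdom x
      rw [hfr]
      rw [hxr] at hx
      obtain ⟨t, ht, h⟩ := hx
      -- Here 2r + 2ta ∈ M with r < 0. If t = 0, rescaling gives -1 ∈ M, so M contains every
      -- self-adjoint element; if t > 0, adding -2r ∈ M and rescaling gives a ∈ M.
      by_contra! hr
      simp only [star_add, star_smul, star_one, star_trivial, ha.star_eq] at h
      rcases ht.eq_or_lt with rfl | ht
      · apply haM
        refine hM.mem_of_neg_one_mem ?_ ha
        have h2 := hM.smul_mem (r := (-(2 * r))⁻¹) (by rw [inv_nonneg]; linarith) h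
        convert h2 using 1
        rw [zero_smul, add_zero, ← add_smul, smul_smul]
        rw [show (-(2 * r))⁻¹ * (r + r) = -1 by
          rw [← two_mul, inv_neg, neg_mul, inv_mul_cancel₀ (by linarith)]]
        simp
      · apply haM
        have h2 := hM.add_mem h (hM.smul_mem (r := -(2 * r)) (by linarith) hM.one_mem)
        have h3 := hM.smul_mem (r := (2 * t)⁻¹) (by positivity) h2
        convert h3 using 1
        have : r • (1 : S) + t • a + (r • 1 + t • a) + -(2 * r) • (1 : S) = (2 * t) • a := by
          module
        rw [this, smul_smul, inv_mul_cancel₀ (by positivity), one_smul])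
    (by
      intro y
      obtain ⟨R, hR⟩ := hM.exists_real_add_mem y
      exact ⟨⟨R • 1, hmem1 R⟩, 0, le_rfl, by simpa using hR⟩)
  refine ⟨g, ⟨?_, fun a b => map_add g a b, fun r a => by simp, ?_⟩, ?_⟩
  · obtain ⟨r, hr, hr'⟩ := hfdom ⟨1, by simpa using hmem1 1⟩
    have h1 := hg ⟨1, by simpa using hmem1 1⟩
    rw [hr'] at h1
    have : r = 1 := by
      have h2 : (r - 1) • (1 : S) = 0 := by rw [sub_smul, one_smul, ← hr, sub_self]
      rcases smul_eq_zero.1 h2 with h | h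
      · linarith
      · exact absurd h hone
    rw [← this]
    exact h1
  · intro s hs
    exact hgP s ⟨0, le_rfl, by simpa using hs⟩
  · have := hgP (-a) ⟨1, zero_le_one, by simpa using hM.zero_mem⟩
    rw [map_neg] at this
    linarith

omit hM [StarModule ℂ S] in
theorem isClosed_moduleStates (M : Set S) : IsClosed (moduleStates M) := by
  simp only [moduleStates, Set.ofPred_and, Set.ofPred_forall]
  refine ((isClosed_eq (continuous_apply _) continuous_const).inter
    (IsClosed.inter ?_ (IsClosed.inter ?_ ?_)))
  · exact isClosed_iInter fun a => isClosed_iInter fun b =>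
      isClosed_eq (continuous_apply _) (by fun_prop)
  · exact isClosed_iInter fun r => isClosed_iInter fun b =>
      isClosed_eq (continuous_apply _) (continuous_const.mul (continuous_apply _))
  · exact isClosed_iInter fun a => isClosed_iInter fun _ =>
      isClosed_le continuous_const (continuous_apply _)

/-- The order unit confines each L s to a fixed interval, so Tychonoff applies in the product
topology. -/
theorem isCompact_moduleStates : IsCompact (moduleStates M) := by
  choose R hR using hM.exists_real_add_mem
  refine IsCompact.of_isClosed_subset
    (isCompact_univ_pi fun s : S => isCompact_Icc (a := -R s) (b := R (-s)))
    (isClosed_moduleStates M) ?_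
  rintro L ⟨h1, hadd, hsmul, hpos⟩ s -
  have e1 := hpos _ (hR s)
  have e2 := hpos _ (hR (-s))
  rw [hadd, hsmul, h1] at e1 e2
  have e3 : L (-s) = -L s := by
    rw [← neg_one_smul ℝ s, hsmul]; ring
  constructor <;> linarith

/-- Elements `N - t^* t` of an archimedean quadratic module are nonnegative multipliers
for all states. -/
theorem state_mul_le {L : S → ℝ} (hL : L ∈ moduleStates M) {t : S} {N : ℝ} (hN : 0 < N)
    (ht : N • (1 : S) - star t * t ∈ M) {m : S} (hm : m ∈ M) :
    L (star t * t * m) ≤ N * L m := by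
  obtain ⟨h1, hadd, hsmul, hpos⟩ := hL
  have hposM : ∀ {a}, a ∈ M → 0 ≤ L a := fun ha => hpos _ (hM.sum_star_mem ha)
  have hsub : ∀ a b, L (a - b) = L a - L b := fun a b => by
    have := hadd (a - b) b
    rw [sub_add_cancel] at this
    linarith
  -- A quadratic module need not be closed under products, so (N - u)m ∈ M is not available.
  -- Instead, the moments L(u^k m) are log-convex and grow at most like N^k.
  set u := star t * t with hu
  have hus : star u = u := by simp [hu, mul_comm]
  have hum : ∀ k {a}, a ∈ M → u ^ k * a ∈ M := by
    intro k a ha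
    have := hM.conj_mem (t ^ k) ha
    rwa [star_pow, ← mul_pow] at this
  have hgr : ∀ k, L (u ^ k) ≤ N ^ k := by
    intro k
    induction k with
    | zero => simp [h1]
    | succ k ih =>
      have := hposM (hum k ht)
      rw [mul_sub, mul_smul_comm, mul_one, ← pow_succ, hsub, hsmul] at this
      calc L (u ^ (k + 1)) ≤ N * L (u ^ k) := by linarith
        _ ≤ N * N ^ k := mul_le_mul_of_nonneg_left ih hN.le
        _ = N ^ (k + 1) := by ring
  obtain ⟨R, hR⟩ : ∃ R : ℝ, R • (1 : S) - m ∈ M := by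
    obtain ⟨R, hR⟩ := hM.exists_real_add_mem (-m)
    refine ⟨R, ?_⟩
    have := hM.smul_mem (r := 1 / 2) (by norm_num) hR
    convert this using 1
    simp only [star_add, star_smul, star_one, star_neg, star_trivial,
      (hM.isSelfAdjoint hm).star_eq]
    module
  have hRpos : 0 ≤ R := by
    have e1 := hposM hR
    have e2 := hposM hm
    rw [hsub, hsmul, h1] at e1
    linarith
  have key := le_mul_of_logConvex_of_growth (a := fun k => L (u ^ k * m)) (N := N) (R := R) hN
    (fun k => hposM (hum k hm))
    (fun k => by
      -- This form is L((x + yu)² u^k m); its discriminant gives log-convexity.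
      have hq : ∀ x y : ℝ, 0 ≤ x * x * L (u ^ k * m) + 2 * (x * y) * L (u ^ (k + 1) * m)
          + y * y * L (u ^ (k + 2) * m) := by
        intro x y
        have := hposM (hM.conj_mem (x • (1 : S) + y • u) (hum k hm))
        simp only [star_add, star_smul, star_one, star_trivial, hus] at this
        have e : (x • (1 : S) + y • u) * (x • 1 + y • u) * (u ^ k * m)
            = (x * x) • (u ^ k * m) + ((2 * (x * y)) • (u ^ (k + 1) * m)
              + (y * y) • (u ^ (k + 2) * m)) := by
          simp only [Algebra.smul_def, map_mul, map_ofNat]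
          ring
        rw [e, hadd, hadd, hsmul, hsmul, hsmul] at this
        linarith
      have := discrim_le_zero (a := L (u ^ k * m)) (b := 2 * L (u ^ (k + 1) * m))
        (c := L (u ^ (k + 2) * m)) (fun x => by have := hq x 1; linarith)
      rw [discrim] at this
      nlinarith)
    (fun k => by
      have := hposM (hum k hR)
      rw [mul_sub, mul_smul_comm, mul_one, hsub, hsmul] at this
      nlinarith [hgr k])
  simpa using key

theorem state_mul_sub_nonneg {L : S → ℝ} (hL : L ∈ moduleStates M) {t : S} {N : ℝ} (hN : 0 < N)
    (ht : N • (1 : S) - star t * t ∈ M) {a : S} (ha : a + star a ∈ M) :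
    0 ≤ L ((N • (1 : S) - star t * t) * a) := by
  have key := hM.state_mul_le hL hN ht ha
  obtain ⟨h1, hadd, hsmul, hpos⟩ := hL
  -- Both signs of b(a - a^*) have real part 0 ∈ M, so L vanishes there. This reduces the claim to
  -- the element a + a^* of M.
  have hskew : ∀ b : S, star b = b → L (b * a) = L (b * star a) := by
    intro b hb
    have e : ∀ r : ℝ, 0 ≤ r * (L (b * a) - L (b * star a)) := by
      intro r
      have : 0 ≤ L (r • (b * a) + (-r) • (b * star a)) := by
        apply hpos
        convert hM.zero_mem using 1
        simp only [star_add, star_smul, star_mul', star_trivial, hb, star_star]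
        module
      rw [hadd, hsmul, hsmul] at this
      linarith
    have e1 := e 1
    have e2 := e (-1)
    linarith
  have hself : star (star t * t) = star t * t := by simp [mul_comm]
  have h2 := hskew _ hself
  have h3 := hskew 1 (star_one _)
  simp only [one_mul] at h3
  have e : (N • (1 : S) - star t * t) * a = N • a + (-1 : ℝ) • (star t * t * a) := by
    rw [sub_mul, smul_mul_assoc, one_mul, neg_one_smul, sub_eq_add_neg]
  rw [e, hadd, hsmul, hsmul]
  rw [mul_add, hadd, hadd] at key
  rw [← h2, ← h3] at key
  linarith

omit [StarModule ℂ S] in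
theorem conj_add_star_mem (t : S) {a : S} (ha : a + star a ∈ M) :
    star t * t * a + star (star t * t * a) ∈ M := by
  convert hM.conj_mem t ha using 1
  simp only [star_mul, star_star]
  ring

/-- Extreme states are multiplicative. -/
theorem extreme_state_mul {L : S → ℝ} (hL : L ∈ Set.extremePoints ℝ (moduleStates M)) (t a : S) :
    L (star t * t * a) = L (star t * t) * L a := by
  obtain ⟨hLs, hext⟩ := mem_extremePoints.1 hL
  obtain ⟨h1, hadd, hsmul, hpos⟩ := id hLs
  have hsub : ∀ a b, L (a - b) = L a - L b := fun a b => by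
    have := hadd (a - b) b
    rw [sub_add_cancel] at this
    linarith
  have htt : 0 ≤ L (star t * t) :=
    hpos _ (hM.sum_star_mem (by simpa using hM.conj_mem t hM.one_mem))
  -- The strict bound keeps the weight (N - c)/N below positive.
  obtain ⟨N, hN, hlt, hNM⟩ : ∃ N : ℝ, 0 < N ∧ L (star t * t) < N ∧
      N • (1 : S) - star t * t ∈ M := by
    obtain ⟨R, hR⟩ := hM.arch t
    rw [Complex.coe_smul] at hR
    have h := hpos _ (hM.sum_star_mem hR)
    rw [hsub, hsmul, h1] at h
    refine ⟨R + 1, by linarith, by linarith, ?_⟩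
    convert hM.add_mem hM.one_mem hR using 1
    rw [add_smul, one_smul]; ring
  -- If L(t^*t) = 0, the order-unit bounds on ±a squeeze L(t^*t a) to 0. Otherwise L is a proper
  -- convex combination of the normalized functionals s ↦ L(t^*t s) and s ↦ L((N - t^*t)s), and
  -- extremality identifies it with the first.
  rcases htt.eq_or_lt with h0 | h0
  · rw [← h0, zero_mul]
    obtain ⟨R, hR⟩ := hM.exists_real_add_mem a
    obtain ⟨R', hR'⟩ := hM.exists_real_add_mem (-a)
    have e1 := hpos _ (hM.conj_add_star_mem t hR)
    have e2 := hpos _ (hM.conj_add_star_mem t hR')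
    have e3 : L (-(star t * t * a)) = - L (star t * t * a) := by
      rw [← neg_one_smul ℝ, hsmul]; ring
    rw [mul_add, mul_smul_comm, mul_one, hadd, hsmul, ← h0] at e1 e2
    rw [mul_neg, e3] at e2
    linarith
  · set c := L (star t * t) with hc
    have hL1 : (fun s => c⁻¹ * L (star t * t * s)) ∈ moduleStates M := by
      refine ⟨?_, fun a b => ?_, fun r a => ?_, fun a ha => ?_⟩
      · simp only [mul_one]; rw [← hc, inv_mul_cancel₀ h0.ne']
      · simp only [mul_add, hadd]
      · simp only [mul_smul_comm, hsmul]; ring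
      · exact mul_nonneg (inv_nonneg.2 h0.le) (hpos _ (hM.conj_add_star_mem t ha))
    have hL2 : (fun s => (N - c)⁻¹ * L ((N • (1 : S) - star t * t) * s)) ∈ moduleStates M := by
      refine ⟨?_, fun a b => ?_, fun r a => ?_, fun a ha => ?_⟩
      · simp only [mul_one, hsub, hsmul, h1]
        rw [← hc, inv_mul_cancel₀ (sub_pos.2 hlt).ne']
      · simp only [mul_add, hadd]
      · simp only [mul_smul_comm, hsmul]; ring
      · exact mul_nonneg (inv_nonneg.2 (sub_pos.2 hlt).le)
          (hM.state_mul_sub_nonneg hLs hN hNM ha)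
    have hseg : L ∈ openSegment ℝ (fun s => c⁻¹ * L (star t * t * s))
        (fun s => (N - c)⁻¹ * L ((N • (1 : S) - star t * t) * s)) := by
      refine ⟨c / N, (N - c) / N, div_pos h0 hN, div_pos (sub_pos.2 hlt) hN, by field_simp; ring,
        ?_⟩
      funext s
      have hNc := (sub_pos.2 hlt).ne'
      simp only [Pi.add_apply, Pi.smul_apply, smul_eq_mul, sub_mul, hsub, smul_mul_assoc, one_mul,
        hsmul]
      field_simp
      ring
    have := congrFun (hext _ hL1 _ hL2 hseg).1 a
    rw [← this]
    field_simp

/-- Archimedean quadratic modules are determined by the characters nonnegative on them. -/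
theorem exists_character_nonpos {a : S} (ha : IsSelfAdjoint a) (haM : a ∉ M) :
    ∃ φ : S →ₐ[ℂ] ℂ, (∀ s, φ (star s) = (starRingEnd ℂ) (φ s)) ∧ (∀ m ∈ M, 0 ≤ φ m) ∧
      (φ a).re ≤ 0 := by
  obtain ⟨L₀, hL₀, hL₀a⟩ := hM.exists_state_nonpos ha haM
  -- The minimizers of evaluation at a form an exposed face; by Krein–Milman it has an extreme
  -- point, which is extreme in the whole state space.
  have hexp : IsExposed ℝ (moduleStates M)
      {x | x ∈ moduleStates M ∧ ∀ y ∈ moduleStates M,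
        (-ContinuousLinearMap.proj a : (S → ℝ) →L[ℝ] ℝ) y
          ≤ (-ContinuousLinearMap.proj a : (S → ℝ) →L[ℝ] ℝ) x} := fun _ => ⟨_, rfl⟩
  obtain ⟨Lm, hLm, hmin⟩ := hM.isCompact_moduleStates.exists_isMinOn ⟨L₀, hL₀⟩
    (continuous_apply a).continuousOn
  obtain ⟨L, hL⟩ := (hexp.isCompact hM.isCompact_moduleStates).extremePoints_nonempty
    ⟨Lm, hLm, fun y hy => by simpa using hmin hy⟩
  have hLa : L a ≤ 0 := by
    have := hL.1.2 L₀ hL₀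
    simp at this
    linarith
  have hLext := hexp.isExtreme.extremePoints_subset_extremePoints hL
  have hmul := hM.extreme_state_mul hLext
  obtain ⟨h1, hadd, hsmul, hpos⟩ := hLext.1
  let Lr : Module.Dual ℝ S :=
    { toFun := L, map_add' := hadd, map_smul' := fun r a => by simp [hsmul] }
  have hstar : ∀ s, L (star s) = L s := by
    intro s
    have e : ∀ r : ℝ, 0 ≤ r * (L (star s) - L s) := by
      intro r
      have : 0 ≤ L (r • star s + (-r) • s) := by
        apply hpos
        convert hM.zero_mem using 1
        simp only [star_add, star_smul, star_trivial, star_star]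
        module
      rw [hadd, hsmul, hsmul] at this
      linarith
    have e1 := e 1
    have e2 := e (-1)
    linarith
  let φ : Module.Dual ℂ S := Lr.extendRCLike
  have hφ : ∀ s, φ s = (L s : ℂ) - Complex.I * (L (Complex.I • s) : ℂ) := fun s =>
    Module.Dual.extendRCLike_apply Lr s
  have hskew : ∀ s, star s = s → L (Complex.I • s) = 0 := by
    intro s hs
    have := hstar (Complex.I • s)
    rw [star_smul, hs, Complex.star_def, Complex.conj_I, neg_smul, ← neg_one_smul ℝ, hsmul] at this
    linarith
  have hφsa : ∀ s, star s = s → φ s = (L s : ℂ) := fun s hs => by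
    rw [hφ, hskew s hs]; simp
  have hφmul : ∀ t s, φ (star t * t * s) = φ (star t * t) * φ s := by
    intro t s
    rw [hφsa (star t * t) (by simp [mul_comm]), hφ, hφ, ← mul_smul_comm, hmul, hmul]
    push_cast
    ring
  have hφmul' : ∀ b s, φ (b * s) = φ b * φ s := by
    intro b s
    -- Polarization extends multiplicativity from hermitian squares to every b.
    have hpol : (4 : ℂ) • b = star (b + 1) * (b + 1) - star (b - 1) * (b - 1)
        + Complex.I • (star (b + Complex.I • 1) * (b + Complex.I • 1)
          - star (b - Complex.I • 1) * (b - Complex.I • 1)) := by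
      have hI : algebraMap ℂ S Complex.I * algebraMap ℂ S Complex.I = -1 := by
        rw [← map_mul, Complex.I_mul_I, map_neg, map_one]
      simp only [star_add, star_sub, star_smul, star_one, Complex.star_def, Complex.conj_I]
      simp only [Algebra.smul_def, map_neg, map_ofNat, mul_one]
      linear_combination (2 * b - 2 * star b) * hI
    have h4 : (4 : ℂ) * φ (b * s) = 4 * (φ b * φ s) := by
      rw [← smul_eq_mul, ← map_smul, ← smul_mul_assoc, hpol, ← mul_assoc, ← smul_eq_mul 4 (φ b),
        ← map_smul, hpol]
      simp only [add_mul, sub_mul, smul_mul_assoc, map_add, map_sub, map_smul, smul_eq_mul, hφmul]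
      ring
    exact mul_left_cancel₀ (by norm_num) h4
  have hφ1 : φ 1 = 1 := by rw [hφsa 1 (star_one S), h1]; simp
  refine ⟨AlgHom.ofLinearMap φ hφ1 hφmul', fun s => ?_, fun m hm => ?_, ?_⟩
  · simp only [AlgHom.ofLinearMap_apply, hφ, hstar, map_sub, map_mul, Complex.conj_I,
      Complex.conj_ofReal]
    have : Complex.I • star s = (-1 : ℝ) • star (Complex.I • s) := by
      rw [star_smul, Complex.star_def, Complex.conj_I]; simp
    rw [this, hsmul, hstar]
    push_cast
    ring
  · simp only [AlgHom.ofLinearMap_apply]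
    rw [hφsa m (hM.isSelfAdjoint hm)]
    exact Complex.zero_le_real.2 (hpos _ (hM.sum_star_mem hm))
  · simp only [AlgHom.ofLinearMap_apply]
    rw [hφsa a ha]
    simpa using hLa

end IsArchimedeanQuadraticModule

end ArchimedeanModules

/-! ### Realizing semi-inner product spaces in ℓ²(ℕ) -/

section SeparableHilbertSpace

open TopologicalSpace

/-- In a separable inner product space every orthonormal family is countable. -/
theorem Orthonormal.countable_of_separable {E ι : Type*} [NormedAddCommGroup E]
    [InnerProductSpace ℂ E] [SeparableSpace E] {v : ι → E} (hv : Orthonormal ℂ v) :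
    Countable ι := by
  have hdist : ∀ i j, i ≠ j → 1 < dist (v i) (v j) := by
    intro i j hij
    have h := @norm_sub_sq ℂ E _ _ _ (v i) (v j)
    rw [hv.1 i, hv.1 j, hv.2 hij] at h
    rw [dist_eq_norm]
    simp only [map_zero] at h
    nlinarith [norm_nonneg (v i - v j)]
  refine Pairwise.countable_of_isOpen_disjoint (s := fun i => Metric.ball (v i) (1 / 2)) ?_
    (fun i => Metric.isOpen_ball) (fun i => ⟨v i, Metric.mem_ball_self (by norm_num)⟩)
  intro i j hij
  exact Metric.ball_disjoint_ball (by linarith [hdist i j hij])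

/-- A Hilbert basis extending e is infinite because of e and countable by separability, so ℕ can
index it. -/
theorem nonempty_linearIsometryEquiv_hilbertL2 {E : Type*} [NormedAddCommGroup E]
    [InnerProductSpace ℂ E] [CompleteSpace E] [SeparableSpace E] {e : ℕ → E}
    (he : Orthonormal ℂ e) : Nonempty (E ≃ₗᵢ[ℂ] HilbertL2) := by
  obtain ⟨w, b, hw, hb⟩ := (he.toSubtypeRange).exists_hilbertBasis_extension
  have hbo := b.orthonormal
  have : Countable w := hbo.countable_of_separable
  have : Infinite w :=
    ((Set.infinite_range_of_injective he.linearIndependent.injective).mono hw).to_subtype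
  obtain ⟨f⟩ := nonempty_equiv_of_countable (α := ℕ) (β := w)
  have hbf : Orthonormal ℂ (b ∘ f) := hbo.comp f f.injective
  refine ⟨(HilbertBasis.mk hbf ?_).repr⟩
  rw [f.surjective.range_comp, b.dense_span]

/-- A complex vector space of countable dimension with a positive semidefinite form that has an
infinite orthonormal sequence is represented densely in `ℓ²(ℕ)`. -/
theorem exists_dense_map_hilbertL2 {V : Type*} [AddCommGroup V] [Module ℂ V]
    (core : PreInnerProductSpace.Core ℂ V) {s : Set V} (hs : s.Countable)
    (hspan : Submodule.span ℂ s = ⊤) (e : ℕ → V)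
    (he : ∀ i j, core.inner (e i) (e j) = if i = j then 1 else 0) :
    ∃ J : V →ₗ[ℂ] HilbertL2, DenseRange J ∧ ∀ u v, inner ℂ (J u) (J v) = core.inner u v := by
  let : SeminormedAddCommGroup V := InnerProductSpace.Core.toSeminormedAddCommGroup (𝕜 := ℂ)
  let : InnerProductSpace ℂ V := InnerProductSpace.ofCore core
  have hsep : IsSeparable (Set.univ : Set V) := by
    have := hs.isSeparable.span (R := ℂ)
    rwa [hspan] at this
  have : SeparableSpace V := isSeparable_univ_iff.1 hsep
  -- The completion is Hausdorff, so null vectors of the form are sent to 0.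
  let ι : V →ₗᵢ[ℂ] UniformSpace.Completion V := UniformSpace.Completion.toComplₗᵢ
  have hon : Orthonormal ℂ (fun i => ι (e i)) := by
    rw [orthonormal_iff_ite]
    intro i j
    rw [ι.inner_map_map]
    exact he i j
  obtain ⟨U⟩ := nonempty_linearIsometryEquiv_hilbertL2 hon
  refine ⟨U.toLinearEquiv.toLinearMap ∘ₗ ι.toLinearMap, ?_, fun u v => ?_⟩
  · exact U.surjective.denseRange.comp UniformSpace.Completion.denseRange_coe U.continuous
  · simp only [LinearMap.comp_apply]
    exact (U.inner_map_map _ _).trans (ι.inner_map_map u v)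

/-- The form `∑ k, ⟨u k, v k⟩` on finitely supported sequences. -/
@[reducible] def PreInnerProductSpace.Core.finsupp {V : Type*} [AddCommGroup V] [Module ℂ V]
    (core : PreInnerProductSpace.Core ℂ V) : PreInnerProductSpace.Core ℂ (ℕ →₀ V) where
  inner u v := u.sum fun k a => core.inner a (v k)
  conj_inner_symm u v := by
    have hz : ∀ a, core.inner 0 a = 0 := fun a => by
      have := core.smul_left 0 a 0
      rwa [zero_smul, map_zero, zero_mul] at this
    have hz' : ∀ a, core.inner a 0 = 0 := fun a => by
      rw [← core.conj_inner_symm, hz, map_zero]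
    rw [Finsupp.sum_of_support_subset v (Finset.subset_union_right (s₁ := u.support)) _
        (by simp [hz]),
      Finsupp.sum_of_support_subset u (Finset.subset_union_left (s₂ := v.support)) _
        (by simp [hz]),
      map_sum]
    exact Finset.sum_congr rfl fun k _ => core.conj_inner_symm _ _
  re_inner_nonneg u := by
    rw [Finsupp.sum, map_sum]
    exact Finset.sum_nonneg fun k _ => core.re_inner_nonneg _
  add_left u u' v := by
    refine Finsupp.sum_add_index' (fun k => ?_) (fun k a b => core.add_left _ _ _)
    have := core.smul_left 0 (v k) 0
    rwa [zero_smul, map_zero, zero_mul] at this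
  smul_left u v r := by
    rw [Finsupp.sum_smul_index', Finsupp.sum, Finsupp.sum, Finset.mul_sum]
    · exact Finset.sum_congr rfl fun k _ => core.smul_left _ _ _
    · intro k
      have := core.smul_left 0 (v k) 0
      rwa [zero_smul, map_zero, zero_mul] at this

end SeparableHilbertSpace

/-! ### State quadratic modules and their archimedean property -/

section StateModules

variable {n : ℕ}

namespace StatePoly

instance instStarModule : StarModule ℂ (StatePoly n) where
  star_smul r p := by
    simp only [MvPolynomial.smul_eq_C_mul, star_mul', star_def, starHom_C]
    rfl

theorem sigmaWord_one : sigmaWord (1 : Word n) = 1 := by simp [sigmaWord]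

theorem sigmaWord_val (w : {w : Word n // w ≠ 1}) :
    sigmaWord w.1 = (MvPolynomial.X w : StatePoly n) := by
  simp [sigmaWord, w.2]

theorem star_sigmaWord (w : Word n) : star (sigmaWord w) = sigmaWord (star w) := by
  by_cases h : w = 1
  · subst h; simp [sigmaWord_one]
  · rw [sigmaWord_val ⟨w, h⟩, star_def, starHom_X, ← sigmaWord_val]
    rfl

end StatePoly

namespace NCStatePoly

theorem star_smul_statePoly (s : StatePoly n) (f : NCStatePoly n) :
    star (s • f) = star s • star f := by
  induction f using MonoidAlgebra.induction_linear with
  | zero => simp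
  | add f g hf hg => rw [smul_add, star_add, hf, hg, star_add, smul_add]
  | single w t => simp [MonoidAlgebra.smul_single, star_single]

instance instStarModule : StarModule ℂ (NCStatePoly n) where
  star_smul r f := by
    rw [← algebraMap_smul (StatePoly n) r f, star_smul_statePoly,
      ← algebraMap_smul (StatePoly n) (star r) (star f), algebraMap_star_comm]

/-- The map `ς` as an `𝒮`-linear map. -/
def sigmaLinear (n : ℕ) : NCStatePoly n →ₗ[StatePoly n] StatePoly n where
  toFun := sigma
  map_add' f g := by
    simp only [sigma, MonoidAlgebra.coeff_add]
    exact Finsupp.sum_add_index' (by simp) (by simp [add_mul])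
  map_smul' s f := by
    simp only [sigma, MonoidAlgebra.coeff_smul, RingHom.id_apply, smul_eq_mul]
    rw [Finsupp.sum_smul_index (by simp), Finsupp.sum, Finsupp.sum, Finset.mul_sum]
    exact Finset.sum_congr rfl fun w _ => mul_assoc _ _ _

theorem sigma_add (f g : NCStatePoly n) : sigma (f + g) = sigma f + sigma g :=
  map_add (sigmaLinear n) f g

theorem sigma_zero : sigma (0 : NCStatePoly n) = 0 := map_zero (sigmaLinear n)

theorem sigma_sub (f g : NCStatePoly n) : sigma (f - g) = sigma f - sigma g :=
  map_sub (sigmaLinear n) f g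

theorem sigma_smul (s : StatePoly n) (f : NCStatePoly n) : sigma (s • f) = s * sigma f :=
  map_smul (sigmaLinear n) s f

theorem sigma_complex_smul (r : ℂ) (f : NCStatePoly n) : sigma (r • f) = r • sigma f := by
  rw [← algebraMap_smul (StatePoly n) r f, sigma_smul, Algebra.smul_def]

theorem sigma_single (w : Word n) (s : StatePoly n) :
    sigma (MonoidAlgebra.single w s) = s * StatePoly.sigmaWord w := by
  simp [sigma, MonoidAlgebra.coeff_single]

theorem sigma_one : sigma (1 : NCStatePoly n) = 1 := by
  rw [MonoidAlgebra.one_def, sigma_single, StatePoly.sigmaWord_one, mul_one]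

theorem sigma_star (f : NCStatePoly n) : sigma (star f) = star (sigma f) := by
  induction f using MonoidAlgebra.induction_linear with
  | zero => simp [sigma_zero]
  | add f g hf hg => simp [sigma_add, hf, hg]
  | single w s => rw [star_single, sigma_single, sigma_single, star_mul', StatePoly.star_sigmaWord]

theorem star_x (j : Fin n) : star (x j) = x j := by
  rw [x, star_single, star_one, FreeMonoid.star_of]

end NCStatePoly

open NCStatePoly

/-- The quadratic module in `𝒮⟨x⟩` generated by `C`. -/
def ncQuadraticModule (C : Set (NCStatePoly n)) : AddSubmonoid (NCStatePoly n) :=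
  AddSubmonoid.closure {q | ∃ g, ∃ c ∈ insert 1 C, q = star g * c * g}

/-- The state quadratic module `QM(C)` in `𝒮`. -/
def stateQuadraticModule (C : Set (NCStatePoly n)) : AddSubmonoid (StatePoly n) :=
  AddSubmonoid.closure {q | ∃ g, ∃ c ∈ insert 1 C, q = sigma (star g * c * g)}

variable {C : Set (NCStatePoly n)}

theorem star_mul_mul_mem_ncQuadraticModule (g : NCStatePoly n) {c : NCStatePoly n}
    (hc : c ∈ insert 1 C) : star g * c * g ∈ ncQuadraticModule C :=
  AddSubmonoid.subset_closure ⟨g, c, hc, rfl⟩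

theorem star_mul_self_mem_ncQuadraticModule (g : NCStatePoly n) :
    star g * g ∈ ncQuadraticModule C := by
  simpa using star_mul_mul_mem_ncQuadraticModule (C := C) g (Set.mem_insert 1 C)

theorem conj_mem_ncQuadraticModule (h : NCStatePoly n) {q : NCStatePoly n}
    (hq : q ∈ ncQuadraticModule C) : star h * q * h ∈ ncQuadraticModule C := by
  induction hq using AddSubmonoid.closure_induction with
  | mem q hq =>
    obtain ⟨g, c, hc, rfl⟩ := hq
    simpa only [star_mul, mul_assoc] using star_mul_mul_mem_ncQuadraticModule (g * h) hc
  | zero => simp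
  | add p q _ _ hp hq =>
    rw [mul_add, add_mul]
    exact add_mem hp hq

theorem smul_mem_ncQuadraticModule {r : ℝ} (hr : 0 ≤ r) {q : NCStatePoly n}
    (hq : q ∈ ncQuadraticModule C) : (r : ℂ) • q ∈ ncQuadraticModule C := by
  have h := conj_mem_ncQuadraticModule (((Real.sqrt r : ℝ) : ℂ) • (1 : NCStatePoly n)) hq
  simpa [star_smul, smul_smul, ← Complex.ofReal_mul, Real.mul_self_sqrt hr] using h

theorem sigma_mem_stateQuadraticModule {q : NCStatePoly n} (hq : q ∈ ncQuadraticModule C) :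
    sigma q ∈ stateQuadraticModule C := by
  induction hq using AddSubmonoid.closure_induction with
  | mem q hq =>
    obtain ⟨g, c, hc, rfl⟩ := hq
    exact AddSubmonoid.subset_closure ⟨g, c, hc, rfl⟩
  | zero => simp [sigma_zero]
  | add p q _ _ hp hq =>
    rw [sigma_add]
    exact add_mem hp hq

theorem conj_mem_stateQuadraticModule (t : StatePoly n) {q : StatePoly n}
    (hq : q ∈ stateQuadraticModule C) : star t * t * q ∈ stateQuadraticModule C := by
  induction hq using AddSubmonoid.closure_induction with
  | mem q hq =>
    obtain ⟨g, c, hc, rfl⟩ := hq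
    -- By 𝒮-linearity of ς, t^*t ς(g^*cg) = ς((tg)^*c(tg)).
    refine AddSubmonoid.subset_closure ⟨t • g, c, hc, ?_⟩
    rw [star_smul_statePoly, smul_mul_assoc, smul_mul_assoc, mul_smul_comm, sigma_smul, sigma_smul,
      mul_assoc]
  | zero => simp
  | add p q _ _ hp hq =>
    rw [mul_add]
    exact add_mem hp hq

theorem one_mem_stateQuadraticModule : 1 ∈ stateQuadraticModule C :=
  AddSubmonoid.subset_closure ⟨1, 1, Set.mem_insert _ _, by simp [sigma_one]⟩

theorem smul_mem_stateQuadraticModule {r : ℝ} (hr : 0 ≤ r) {q : StatePoly n}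
    (hq : q ∈ stateQuadraticModule C) : (r : ℂ) • q ∈ stateQuadraticModule C := by
  have h := conj_mem_stateQuadraticModule (((Real.sqrt r : ℝ) : ℂ) • (1 : StatePoly n)) hq
  simpa [star_smul, smul_smul, ← Complex.ofReal_mul, Real.mul_self_sqrt hr] using h

theorem isSelfAdjoint_of_mem_stateQuadraticModule (hC : ∀ c ∈ C, IsSelfAdjoint c)
    {q : StatePoly n} (hq : q ∈ stateQuadraticModule C) : IsSelfAdjoint q := by
  induction hq using AddSubmonoid.closure_induction with
  | mem q hq =>
    obtain ⟨g, c, hc, rfl⟩ := hq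
    have hc' : star c = c := by
      rcases hc with rfl | hc
      · exact star_one _
      · exact (hC c hc).star_eq
    rw [IsSelfAdjoint, ← sigma_star]
    simp only [star_mul, star_star, hc', mul_assoc]
  | zero => exact IsSelfAdjoint.zero _
  | add p q _ _ hp hq => exact hp.add hq

/-- Adding back the squares x_i² with i ≠ j isolates one variable. -/
theorem exists_sub_sq_mem_ncQuadraticModule (hArch : IsArchimedeanConstraintSet C) :
    ∃ N : ℝ, 0 < N ∧ ∀ j, (N : ℂ) • (1 : NCStatePoly n) - x j * x j ∈ ncQuadraticModule C := by
  obtain ⟨N, hN, m, g, c, hc, hsum⟩ := hArch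
  refine ⟨N, hN, fun j => ?_⟩
  have h1 : algebraMap ℂ (NCStatePoly n) (N : ℂ) - ∑ i, x i ^ 2 ∈ ncQuadraticModule C := by
    rw [hsum]
    exact sum_mem fun i _ => star_mul_mul_mem_ncQuadraticModule (g i) (hc i)
  have h2 : ∑ i ∈ Finset.univ.erase j, (x i : NCStatePoly n) ^ 2 ∈ ncQuadraticModule C :=
    sum_mem fun i _ => by
      have := star_mul_self_mem_ncQuadraticModule (C := C) (x i)
      rwa [star_x, ← sq] at this
  convert add_mem h1 h2 using 1
  rw [← Finset.add_sum_erase _ _ (Finset.mem_univ j), Algebra.algebraMap_eq_smul_one, sq (x j)]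
  abel

theorem exists_sub_word_mem_ncQuadraticModule (hArch : IsArchimedeanConstraintSet C)
    (w : Word n) : ∃ R : ℝ, 0 ≤ R ∧ (R : ℂ) • (1 : NCStatePoly n)
      - star (MonoidAlgebra.single w 1) * MonoidAlgebra.single w 1 ∈ ncQuadraticModule C := by
  obtain ⟨N, hN, hx⟩ := exists_sub_sq_mem_ncQuadraticModule hArch
  induction w using FreeMonoid.inductionOn' with
  | one =>
    refine ⟨1, zero_le_one, ?_⟩
    rw [← MonoidAlgebra.one_def]
    simp
  | of_mul j w ih =>
    obtain ⟨R, hR, h⟩ := ih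
    refine ⟨N * R, by positivity, ?_⟩
    have e : (MonoidAlgebra.single (FreeMonoid.of j * w) 1 : NCStatePoly n)
        = x j * MonoidAlgebra.single w 1 := by
      rw [x, MonoidAlgebra.single_mul_single, mul_one]
    rw [e, star_mul, star_x]
    -- NR - w^*x_j²w = N(R - w^*w) + w^*(N - x_j²)w.
    convert add_mem (smul_mem_ncQuadraticModule hN.le h)
      (conj_mem_ncQuadraticModule (MonoidAlgebra.single w 1) (hx j)) using 1
    rw [smul_sub, smul_smul, mul_sub, sub_mul, mul_smul_comm, smul_mul_assoc, mul_one]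
    push_cast
    simp only [mul_assoc]
    abel

theorem exists_sub_mem_stateQuadraticModule (hArch : IsArchimedeanConstraintSet C)
    (s : StatePoly n) :
    ∃ R : ℝ, 0 ≤ R ∧ (R : ℂ) • (1 : StatePoly n) - star s * s ∈ stateQuadraticModule C := by
  induction s using MvPolynomial.induction_on with
  | C a =>
    refine ⟨Complex.normSq a, Complex.normSq_nonneg a, ?_⟩
    rw [StatePoly.star_def, StatePoly.starHom_C, ← map_mul, ← Complex.normSq_eq_conj_mul_self,
      MvPolynomial.smul_eq_C_mul, mul_one, sub_self]
    exact zero_mem _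
  | add p q hp hq =>
    obtain ⟨R₁, h₁, hp⟩ := hp
    obtain ⟨R₂, h₂, hq⟩ := hq
    refine ⟨2 * R₁ + 2 * R₂, by positivity, ?_⟩
    -- Parallelogram law: (p + q)^*(p + q) + (p - q)^*(p - q) = 2p^*p + 2q^*q.
    have h2 := add_mem (add_mem (add_mem hp hp) (add_mem hq hq))
      (conj_mem_stateQuadraticModule (p - q) one_mem_stateQuadraticModule)
    convert h2 using 1
    simp only [star_add, star_sub, MvPolynomial.smul_eq_C_mul, Complex.ofReal_add,
      Complex.ofReal_mul, Complex.ofReal_ofNat, map_add, map_mul, map_ofNat]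
    ring
  | mul_X p w hp =>
    obtain ⟨R₁, h₁, hp⟩ := hp
    obtain ⟨R₂, h₂, hw⟩ := exists_sub_word_mem_ncQuadraticModule hArch w.1
    -- Cauchy–Schwarz as a variance: ς((w - ς(w))^*(w - ς(w))) = ς(w^*w) - ς(w)^*ς(w).
    have hw' : (R₂ : ℂ) • (1 : StatePoly n) - star (MvPolynomial.X w) * MvPolynomial.X w
        ∈ stateQuadraticModule C := by
      have e1 := sigma_mem_stateQuadraticModule hw
      have e2 := sigma_mem_stateQuadraticModule (star_mul_self_mem_ncQuadraticModule (C := C)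
        (MonoidAlgebra.single w.1 1 - MonoidAlgebra.single 1 (MvPolynomial.X w)))
      convert add_mem e1 e2 using 1
      simp only [star_sub, sub_mul, mul_sub, star_single, MonoidAlgebra.single_mul_single, sigma_sub,
        sigma_complex_smul, sigma_one, sigma_single, star_one, mul_one, one_mul,
        StatePoly.sigmaWord_one, ← StatePoly.star_sigmaWord, StatePoly.sigmaWord_val]
      ring
    refine ⟨R₁ * R₂, by positivity, ?_⟩
    -- With X = ς(w): R₁R₂ - p^*p X^*X = X^*X(R₁ - p^*p) + R₁(R₂ - X^*X).
    convert add_mem (conj_mem_stateQuadraticModule (MvPolynomial.X w) hp)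
      (smul_mem_stateQuadraticModule h₁ hw') using 1
    simp only [star_mul', MvPolynomial.smul_eq_C_mul, Complex.ofReal_mul, map_mul]
    ring

theorem isArchimedeanQuadraticModule_stateQuadraticModule (hC : ∀ c ∈ C, IsSelfAdjoint c)
    (hArch : IsArchimedeanConstraintSet C) :
    IsArchimedeanQuadraticModule (stateQuadraticModule C : Set (StatePoly n)) where
  one_mem := one_mem_stateQuadraticModule
  add_mem ha hb := add_mem ha hb
  conj_mem t _ ha := conj_mem_stateQuadraticModule t ha
  isSelfAdjoint ha := isSelfAdjoint_of_mem_stateQuadraticModule hC ha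
  arch a := by
    obtain ⟨R, -, hR⟩ := exists_sub_mem_stateQuadraticModule hArch a
    exact ⟨R, hR⟩

theorem truncatedQM_mono (C : Set (NCStatePoly n)) : Monotone (truncatedQM C) := by
  rintro d e hde q ⟨m, g, c, hc, hdeg, rfl⟩
  exact ⟨m, g, c, hc, fun j => (hdeg j).trans (by lia), rfl⟩

theorem truncatedQM_subset (d : ℕ) : truncatedQM C d ⊆ stateQuadraticModule C := by
  rintro q ⟨m, g, c, hc, -, rfl⟩
  exact sum_mem fun j _ => AddSubmonoid.subset_closure ⟨g j, c j, hc j, rfl⟩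

theorem exists_mem_truncatedQM {q : StatePoly n} (hq : q ∈ stateQuadraticModule C) :
    ∃ d, q ∈ truncatedQM C d := by
  induction hq using AddSubmonoid.closure_induction with
  | mem q hq =>
    obtain ⟨g, c, hc, rfl⟩ := hq
    exact ⟨degree (star g * c * g), 1, fun _ => g, fun _ => c, fun _ => hc, fun _ => by lia,
      by simp⟩
  | zero => exact ⟨0, 0, Fin.elim0, Fin.elim0, fun j => j.elim0, fun j => j.elim0, by simp⟩
  | add p q _ _ hp hq =>
    obtain ⟨d, hp⟩ := hp
    obtain ⟨e, hq⟩ := hq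
    obtain ⟨m, g, c, hc, hdeg, rfl⟩ := truncatedQM_mono C (le_max_left d e) hp
    obtain ⟨m', g', c', hc', hdeg', rfl⟩ := truncatedQM_mono C (le_max_right d e) hq
    refine ⟨max d e, m + m', Fin.append g g', Fin.append c c', ?_, ?_, ?_⟩
    · refine Fin.addCases (fun i => ?_) fun i => ?_
      · simpa using hc i
      · simpa using hc' i
    · refine Fin.addCases (fun i => ?_) fun i => ?_
      · simpa using hdeg i
      · simpa using hdeg' i
    · simp [Fin.sum_univ_add]

end StateModules

/-! ### GNS realization of characters on ℓ²(ℕ) -/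

section StateRealization

variable {n : ℕ}

open NCStatePoly

namespace NCStatePoly

/-- Left multiplication on finitely supported sequences of noncommutative state polynomials. -/
def leftMul (a : NCStatePoly n) : (ℕ →₀ NCStatePoly n) →ₗ[ℂ] (ℕ →₀ NCStatePoly n) :=
  Finsupp.mapRange.linearMap (LinearMap.mulLeft ℂ a)

theorem leftMul_apply (a : NCStatePoly n) (u : ℕ →₀ NCStatePoly n) (k : ℕ) :
    leftMul a u k = a * u k := rfl

theorem leftMul_add (a b : NCStatePoly n) (u : ℕ →₀ NCStatePoly n) :
    leftMul (a + b) u = leftMul a u + leftMul b u :=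
  Finsupp.ext fun k => by simp only [leftMul_apply, Finsupp.add_apply, add_mul]

theorem leftMul_mul (a b : NCStatePoly n) (u : ℕ →₀ NCStatePoly n) :
    leftMul (a * b) u = leftMul a (leftMul b u) :=
  Finsupp.ext fun k => by simp only [leftMul_apply, mul_assoc]

theorem leftMul_one (u : ℕ →₀ NCStatePoly n) : leftMul 1 u = u :=
  Finsupp.ext fun k => by simp only [leftMul_apply, one_mul]

theorem leftMul_zero (u : ℕ →₀ NCStatePoly n) : leftMul 0 u = 0 :=
  Finsupp.ext fun k => by simp only [leftMul_apply, zero_mul, Finsupp.zero_apply]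

theorem leftMul_single (a b : NCStatePoly n) (k : ℕ) :
    leftMul a (Finsupp.single k b) = Finsupp.single k (a * b) := by
  simp [leftMul]

/-- The semi-inner product `⟨f, g⟩ = φ(ς(f^* g))` of a character `φ` of `𝒮`. -/
@[reducible] def stateCore (φ : StatePoly n →ₐ[ℂ] ℂ)
    (hstar : ∀ s, φ (star s) = (starRingEnd ℂ) (φ s))
    (hpos : ∀ g : NCStatePoly n, 0 ≤ φ (sigma (star g * g))) :
    PreInnerProductSpace.Core ℂ (NCStatePoly n) where
  inner f g := φ (sigma (star f * g))
  conj_inner_symm f g := by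
    rw [← hstar, ← sigma_star, star_mul, star_star]
  re_inner_nonneg f := (Complex.nonneg_iff.1 (hpos f)).1
  add_left f g h := by rw [star_add, add_mul, sigma_add, map_add]
  smul_left f g r := by
    rw [star_smul, smul_mul_assoc, sigma_complex_smul, map_smul]
    rfl

/-- The index set is countable, which gives the separability of the GNS space. -/
theorem span_single_monomial_eq_top :
    Submodule.span ℂ (Set.range fun p : ℕ × Word n × ({w : Word n // w ≠ 1} →₀ ℕ) =>
      (Finsupp.single p.1 (MonoidAlgebra.single p.2.1 (MvPolynomial.monomial p.2.2 1)) :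
        ℕ →₀ NCStatePoly n)) = ⊤ := by
  rw [eq_top_iff]
  rintro u -
  induction u using Finsupp.induction_linear with
  | zero => exact zero_mem _
  | add u v hu hv => exact add_mem hu hv
  | single k f =>
    induction f using MonoidAlgebra.induction_linear with
    | zero => simp
    | add f g hf hg => rw [Finsupp.single_add]; exact add_mem hf hg
    | single w s =>
      induction s using MvPolynomial.induction_on' with
      | add p q hp hq =>
        rw [MonoidAlgebra.single_add, Finsupp.single_add]; exact add_mem hp hq
      | monomial m a =>
        have : (Finsupp.single k (MonoidAlgebra.single w (MvPolynomial.monomial m a)) :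
            ℕ →₀ NCStatePoly n)
            = a • Finsupp.single k (MonoidAlgebra.single w (MvPolynomial.monomial m 1)) := by
          rw [Finsupp.smul_single, MonoidAlgebra.smul_single, MvPolynomial.smul_monomial,
            smul_eq_mul, mul_one]
        rw [this]
        exact Submodule.smul_mem _ _ (Submodule.subset_span ⟨(k, w, m), rfl⟩)

end NCStatePoly

/-- The vector state `A ↦ ⟨v, A v⟩` of a unit vector. -/
def OpState.ofUnitVector (v : HilbertL2) (hv : inner ℂ v v = 1) : OpState where
  toLinearMap :=
    { toFun := fun A => inner ℂ v (A v)
      map_add' := fun A B => by rw [add_apply, inner_add_right]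
      map_smul' := fun r A => by
        rw [smul_apply, inner_smul_right, RingHom.id_apply, smul_eq_mul] }
  nonneg A hA := hA.inner_nonneg_right v
  unital := hv

theorem OpState.ofUnitVector_apply (v : HilbertL2) (hv : inner ℂ v v = 1) (A : BoundedOp) :
    (OpState.ofUnitVector v hv).toLinearMap A = inner ℂ v (A v) := rfl

theorem NCStatePoly.eval_add (lam : OpState) (X : Fin n → BoundedOp) (f g : NCStatePoly n) :
    NCStatePoly.eval lam X (f + g) = NCStatePoly.eval lam X f + NCStatePoly.eval lam X g := by
  simp only [NCStatePoly.eval, MonoidAlgebra.coeff_add]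
  exact Finsupp.sum_add_index' (by simp [StatePoly.eval]) (by simp [StatePoly.eval, add_smul])

theorem NCStatePoly.eval_zero (lam : OpState) (X : Fin n → BoundedOp) :
    NCStatePoly.eval lam X (0 : NCStatePoly n) = 0 := by
  simp [NCStatePoly.eval]

theorem NCStatePoly.eval_single (lam : OpState) (X : Fin n → BoundedOp) (w : Word n)
    (s : StatePoly n) : NCStatePoly.eval lam X (MonoidAlgebra.single w s)
      = StatePoly.eval lam X s • evalWord X w := by
  simp [NCStatePoly.eval, StatePoly.eval, MonoidAlgebra.coeff_single]

theorem StatePoly.eval_sigmaWord (lam : OpState) (X : Fin n → BoundedOp) (w : Word n) :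
    StatePoly.eval lam X (StatePoly.sigmaWord w) = lam.toLinearMap (evalWord X w) := by
  by_cases h : w = 1
  · subst h
    simp [StatePoly.sigmaWord_one, StatePoly.eval, evalWord, lam.unital]
  · rw [StatePoly.sigmaWord_val ⟨w, h⟩, StatePoly.eval, MvPolynomial.aeval_X]

/-- A `*`-character of `𝒮` that is nonnegative on an archimedean state quadratic module is the
evaluation at a point of the state semialgebraic set. -/
theorem exists_mem_stateDomain_of_character {C : Set (NCStatePoly n)}
    (hC : ∀ c ∈ C, IsSelfAdjoint c) (hArch : IsArchimedeanConstraintSet C)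
    (φ : StatePoly n →ₐ[ℂ] ℂ) (hstar : ∀ s, φ (star s) = (starRingEnd ℂ) (φ s))
    (hpos : ∀ q ∈ stateQuadraticModule C, 0 ≤ φ q) :
    ∃ p ∈ stateDomain C, ∀ s, StatePoly.eval p.1 p.2 s = φ s := by
  have hposQ : ∀ q ∈ ncQuadraticModule C, ∀ g : NCStatePoly n,
      0 ≤ φ (sigma (star g * (q * g))) := fun q hq g => by
    rw [← mul_assoc]
    exact hpos _ (sigma_mem_stateQuadraticModule (conj_mem_ncQuadraticModule g hq))
  have hpos1 : ∀ g : NCStatePoly n, 0 ≤ φ (sigma (star g * g)) := fun g =>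
    hpos _ (sigma_mem_stateQuadraticModule (star_mul_self_mem_ncQuadraticModule g))
  -- A single GNS space may be finite-dimensional; in countably many copies the classes of 1 form an
  -- infinite orthonormal sequence.
  let B := (stateCore φ hstar hpos1).finsupp
  have hB : ∀ u v, B.inner u v = u.sum fun k a => φ (sigma (star a * v k)) := fun _ _ => rfl
  obtain ⟨J, hJd, hJ⟩ := exists_dense_map_hilbertL2 B (Set.countable_range _)
    span_single_monomial_eq_top (fun k => Finsupp.single k 1) (fun i j => by
      rw [hB, Finsupp.sum_single_index (by simp [sigma_zero]), star_one, one_mul,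
        Finsupp.single_apply]
      by_cases h : i = j
      · simp [h, sigma_one]
      · simp [h, Ne.symm h, sigma_zero])
  have hleft : ∀ a u v,
      inner ℂ (J (leftMul a u)) (J v) = inner ℂ (J u) (J (leftMul (star a) v)) := by
    intro a u v
    rw [hJ, hJ, hB, hB, leftMul, Finsupp.mapRange.linearMap_apply,
      Finsupp.sum_mapRange_index (by simp [sigma_zero])]
    refine Finset.sum_congr rfl fun k _ => ?_
    simp only [LinearMap.mulLeft_apply, star_mul, leftMul_apply, mul_assoc]
  have hQ : ∀ q ∈ ncQuadraticModule C, ∀ u, 0 ≤ inner ℂ (J u) (J (leftMul q u)) := by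
    intro q hq u
    rw [hJ, hB]
    exact Finset.sum_nonneg fun k _ => hposQ q hq _
  -- Multiplicativity of φ enters here: φ(ς(p^* s q)) = φ(s) φ(ς(p^*q)).
  have hscal : ∀ (s : StatePoly n) (v), J (leftMul (MonoidAlgebra.single 1 s) v) = φ s • J v := by
    intro s v
    refine hJd.eq_of_inner_right ℂ fun u => ?_
    rw [inner_smul_right, hJ, hJ, hB, hB, Finsupp.sum, Finsupp.sum, Finset.mul_sum]
    refine Finset.sum_congr rfl fun k _ => ?_
    have : (MonoidAlgebra.single 1 s : NCStatePoly n) = s • 1 := by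
      rw [MonoidAlgebra.one_def, MonoidAlgebra.smul_single, smul_eq_mul, mul_one]
    rw [leftMul_apply, this, smul_mul_assoc, one_mul, mul_smul_comm, sigma_smul, map_mul]
  obtain ⟨N, hN, hx⟩ := exists_sub_sq_mem_ncQuadraticModule hArch
  -- N‖Ju‖² - ‖J(x_j u)‖² = ⟨Ju, J((N - x_j²)u)⟩ ≥ 0. The bound also makes the operator well defined
  -- modulo the kernel of J.
  have hbound : ∀ j u, ‖J (leftMul (x j) u)‖ ≤ Real.sqrt N * ‖J u‖ := by
    intro j u
    have h1 := (Complex.nonneg_iff.1 (hQ _ (hx j) u)).1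
    have h2 : J (leftMul ((N : ℂ) • (1 : NCStatePoly n) - x j * x j) u)
        = (N : ℂ) • J u - J (leftMul (x j) (leftMul (x j) u)) := by
      rw [← map_smul, ← map_sub]
      congr 1
      refine Finsupp.ext fun k => ?_
      simp only [leftMul_apply, Finsupp.sub_apply, Finsupp.smul_apply, sub_mul, smul_mul_assoc,
        one_mul, mul_assoc]
    have h3 := hleft (x j) u (leftMul (x j) u)
    rw [star_x] at h3
    rw [h2, inner_sub_right, inner_smul_right, ← h3, Complex.sub_re, Complex.re_ofReal_mul] at h1
    have h4 : ∀ z : HilbertL2, (inner ℂ z z).re = ‖z‖ ^ 2 := fun z =>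
      (norm_sq_eq_re_inner (𝕜 := ℂ) z).symm
    rw [h4, h4] at h1
    rw [← Real.sqrt_sq (norm_nonneg (J u)), ← Real.sqrt_mul hN.le]
    exact Real.le_sqrt_of_sq_le (by linarith)
  let X : Fin n → BoundedOp := fun j => (J ∘ₗ leftMul (x j)).extendOfNorm J
  have hXJ : ∀ j u, X j (J u) = J (leftMul (x j) u) := fun j u =>
    LinearMap.extendOfNorm_eq hJd ⟨_, hbound j⟩ u
  have hXsa : ∀ j, IsSelfAdjoint (X j) := by
    intro j
    rw [ContinuousLinearMap.isSelfAdjoint_iff_isSymmetric]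
    have hcl : ∀ a b : HilbertL2, inner ℂ (X j a) b = inner ℂ a (X j b) := by
      intro a b
      refine hJd.induction_on₂ (p := fun a b => inner ℂ (X j a) b = inner ℂ a (X j b))
        (isClosed_eq (by fun_prop) (by fun_prop)) (fun u v => ?_) a b
      rw [hXJ, hXJ, hleft, star_x]
    exact hcl
  have hword : ∀ w u, evalWord X w (J u) = J (leftMul (MonoidAlgebra.single w 1) u) := by
    intro w u
    induction w using FreeMonoid.inductionOn' with
    | one => rw [← MonoidAlgebra.one_def, leftMul_one]; simp [evalWord]
    | of_mul j w ih =>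
      have e : (MonoidAlgebra.single (FreeMonoid.of j * w) 1 : NCStatePoly n)
          = x j * MonoidAlgebra.single w 1 := by
        rw [x, MonoidAlgebra.single_mul_single, mul_one]
      rw [e, leftMul_mul, ← hXJ, ← ih]
      simp [evalWord]
  let Ω : ℕ →₀ NCStatePoly n := Finsupp.single 0 1
  have hΩ : inner ℂ (J Ω) (J Ω) = 1 := by
    rw [hJ, hB, Finsupp.sum_single_index (by simp [sigma_zero])]
    simp [Ω, sigma_one]
  let lam := OpState.ofUnitVector (J Ω) hΩ
  have hlam : ∀ w, lam.toLinearMap (evalWord X w) = φ (StatePoly.sigmaWord w) := by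
    intro w
    rw [OpState.ofUnitVector_apply, hword, hJ, hB, Finsupp.sum_single_index (by simp [sigma_zero]),
      leftMul_single, star_one, one_mul, mul_one, Finsupp.single_eq_same, sigma_single, one_mul]
  have heval : ∀ s, StatePoly.eval lam X s = φ s := by
    intro s
    have : MvPolynomial.aeval (fun w : {w : Word n // w ≠ 1} => lam.toLinearMap (evalWord X w.1))
        = φ := by
      refine MvPolynomial.algHom_ext fun w => ?_
      rw [MvPolynomial.aeval_X, hlam, StatePoly.sigmaWord_val]
    exact DFunLike.congr_fun this s
  -- Coefficients act as the scalars given by φ, which are also their state evaluations, so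
  -- evaluation at (lam, X) is left multiplication on the dense range of J.
  have hncEval : ∀ f u, NCStatePoly.eval lam X f (J u) = J (leftMul f u) := by
    intro f u
    induction f using MonoidAlgebra.induction_linear with
    | zero => simp [NCStatePoly.eval_zero, leftMul_zero]
    | add f g hf hg =>
      rw [NCStatePoly.eval_add, add_apply, hf, hg, leftMul_add, map_add]
    | single w s =>
      rw [NCStatePoly.eval_single, smul_apply, hword, heval, ← hscal, ← leftMul_mul,
        MonoidAlgebra.single_mul_single, one_mul, mul_one]
  refine ⟨(lam, X), ⟨hXsa, fun c hc => ?_⟩, heval⟩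
  rw [ContinuousLinearMap.isPositive_iff_complex]
  have hclosed : ∀ v : HilbertL2, 0 ≤ inner ℂ (NCStatePoly.eval lam X c v) v := by
    intro v
    refine hJd.induction_on (p := fun v => 0 ≤ inner ℂ (NCStatePoly.eval lam X c v) v) v
      (isClosed_le continuous_const (by fun_prop)) fun u => ?_
    rw [hncEval, hleft, (hC c hc).star_eq]
    refine hQ c ?_ u
    simpa using star_mul_mul_mem_ncQuadraticModule (C := C) 1 (Set.mem_insert_of_mem 1 hc)
  intro v
  obtain ⟨h1, h2⟩ := Complex.nonneg_iff.1 (hclosed v)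
  exact ⟨Complex.ext rfl h2, h1⟩

end StateRealization

/-! ### Soundness, the Positivstellensatz and the bounds -/

section StateBounds

variable {n : ℕ}

open NCStatePoly

theorem NCStatePoly.eval_mul (lam : OpState) (X : Fin n → BoundedOp) (f g : NCStatePoly n) :
    NCStatePoly.eval lam X (f * g) = NCStatePoly.eval lam X f * NCStatePoly.eval lam X g := by
  induction f using MonoidAlgebra.induction_linear with
  | zero => simp [NCStatePoly.eval_zero]
  | add f₁ f₂ h₁ h₂ => rw [add_mul, eval_add, h₁, h₂, eval_add, add_mul]
  | single w s =>
    induction g using MonoidAlgebra.induction_linear with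
    | zero => simp [NCStatePoly.eval_zero]
    | add g₁ g₂ h₁ h₂ => rw [mul_add, eval_add, h₁, h₂, eval_add, mul_add]
    | single v t =>
      rw [MonoidAlgebra.single_mul_single, eval_single, eval_single, eval_single,
        smul_mul_smul_comm, evalWord, evalWord, evalWord, map_mul, StatePoly.eval, map_mul]
      rfl

theorem NCStatePoly.eval_one (lam : OpState) (X : Fin n → BoundedOp) :
    NCStatePoly.eval lam X (1 : NCStatePoly n) = 1 := by
  rw [MonoidAlgebra.one_def, eval_single]
  simp [StatePoly.eval, evalWord]

theorem NCStatePoly.eval_star (lam : OpState) {X : Fin n → BoundedOp}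
    (hX : ∀ j, IsSelfAdjoint (X j)) (f : NCStatePoly n) :
    NCStatePoly.eval lam X (star f) = star (NCStatePoly.eval lam X f) := by
  induction f using MonoidAlgebra.induction_linear with
  | zero => simp [NCStatePoly.eval_zero]
  | add f g hf hg => rw [star_add, eval_add, hf, hg, eval_add, star_add]
  | single w s =>
    rw [star_single, eval_single, eval_single, StatePoly.eval_star lam hX, evalWord_star hX,
      star_smul]
    rfl

theorem StatePoly.eval_sigma (lam : OpState) (X : Fin n → BoundedOp) (f : NCStatePoly n) :
    StatePoly.eval lam X (sigma f) = lam.toLinearMap (NCStatePoly.eval lam X f) := by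
  induction f using MonoidAlgebra.induction_linear with
  | zero => simp [NCStatePoly.eval_zero, sigma_zero, StatePoly.eval]
  | add f g hf hg =>
    rw [sigma_add, NCStatePoly.eval_add, map_add, ← hf, ← hg, StatePoly.eval, map_add]
    rfl
  | single w s =>
    rw [sigma_single, NCStatePoly.eval_single, map_smul, ← StatePoly.eval_sigmaWord,
      StatePoly.eval, map_mul]
    rfl

variable {C : Set (NCStatePoly n)}

theorem eval_nonneg_of_mem_stateQuadraticModule {p : OpState × (Fin n → BoundedOp)}
    (hp : p ∈ stateDomain C) {q : StatePoly n} (hq : q ∈ stateQuadraticModule C) :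
    0 ≤ StatePoly.eval p.1 p.2 q := by
  induction hq using AddSubmonoid.closure_induction with
  | mem q hq =>
    obtain ⟨g, c, hc, rfl⟩ := hq
    have hcpos : (NCStatePoly.eval p.1 p.2 c).IsPositive := by
      rcases hc with rfl | hc
      · rw [NCStatePoly.eval_one]
        exact ContinuousLinearMap.isPositive_one
      · exact hp.2 c hc
    rw [StatePoly.eval_sigma, NCStatePoly.eval_mul, NCStatePoly.eval_mul,
      NCStatePoly.eval_star _ hp.1]
    refine p.1.nonneg _ ?_
    rw [mul_assoc]
    exact hcpos.adjoint_conj _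
  | zero => simp [StatePoly.eval]
  | add q r _ _ hq hr =>
    rw [StatePoly.eval, map_add]
    exact add_nonneg hq hr

theorem le_stateInf_of_sub_mem {f : StatePoly n} {α : ℝ}
    (h : f - MvPolynomial.C (α : ℂ) ∈ stateQuadraticModule C) : (α : EReal) ≤ stateInf C f := by
  refine le_iInf₂ fun p hp => ?_
  have h1 := (Complex.nonneg_iff.1 (eval_nonneg_of_mem_stateQuadraticModule hp h)).1
  rw [StatePoly.eval, map_sub, MvPolynomial.aeval_C, Complex.sub_re, Algebra.algebraMap_self,
    RingHom.id_apply, Complex.ofReal_re, sub_nonneg] at h1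
  exact EReal.coe_le_coe_iff.2 h1

theorem sub_mem_of_lt_stateInf (hC : ∀ c ∈ C, IsSelfAdjoint c)
    (hArch : IsArchimedeanConstraintSet C) {f : StatePoly n} (hf : IsSelfAdjoint f) {α : ℝ}
    (hα : (α : EReal) < stateInf C f) :
    f - MvPolynomial.C (α : ℂ) ∈ stateQuadraticModule C := by
  by_contra hmem
  have hsa : IsSelfAdjoint (f - MvPolynomial.C (α : ℂ)) := by
    refine hf.sub ?_
    rw [IsSelfAdjoint, StatePoly.star_def, StatePoly.starHom_C, Complex.conj_ofReal]
  obtain ⟨φ, hstar, hpos, hle⟩ :=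
    (isArchimedeanQuadraticModule_stateQuadraticModule hC hArch).exists_character_nonpos hsa hmem
  obtain ⟨p, hp, heval⟩ := exists_mem_stateDomain_of_character hC hArch φ hstar hpos
  have h1 : (φ f).re ≤ α := by
    rw [← MvPolynomial.algebraMap_eq, map_sub, AlgHom.commutes, Complex.sub_re] at hle
    simpa using hle
  refine hα.not_ge ((iInf₂_le p hp).trans ?_)
  rw [heval]
  exact EReal.coe_le_coe_iff.2 h1

/-- The order-unit property bounds f from below by a certificate; this excludes the value -∞ for the
infimum. -/
theorem exists_sub_mem_of_isSelfAdjoint (hC : ∀ c ∈ C, IsSelfAdjoint c)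
    (hArch : IsArchimedeanConstraintSet C) {f : StatePoly n} (hf : IsSelfAdjoint f) :
    ∃ α : ℝ, f - MvPolynomial.C (α : ℂ) ∈ stateQuadraticModule C := by
  have hM := isArchimedeanQuadraticModule_stateQuadraticModule hC hArch
  obtain ⟨R, hR⟩ := hM.exists_real_add_mem f
  refine ⟨-R, ?_⟩
  have h := smul_mem_stateQuadraticModule (r := 1 / 2) (by norm_num) hR
  convert h using 1
  rw [← Complex.coe_smul, star_add, star_smul, star_one, hf.star_eq, Complex.star_def,
    Complex.conj_ofReal, ← two_mul, ← mul_one (MvPolynomial.C _), ← MvPolynomial.smul_eq_C_mul]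
  rw [two_mul, smul_add, ← add_smul]
  push_cast
  module

theorem sosBound_mono (C : Set (NCStatePoly n)) (f : StatePoly n) : Monotone (sosBound C f) :=
  fun _ _ hde => sSup_le_sSup (Set.image_mono fun _ hα => truncatedQM_mono C hde hα)

theorem iSup_sosBound (hC : ∀ c ∈ C, IsSelfAdjoint c) (hArch : IsArchimedeanConstraintSet C)
    {f : StatePoly n} (hf : IsSelfAdjoint f) : ⨆ d, sosBound C f d = stateInf C f := by
  refine le_antisymm (iSup_le fun d => sSup_le ?_) (le_of_forall_lt fun a ha => ?_)
  · rintro _ ⟨α, hα, rfl⟩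
    exact le_stateInf_of_sub_mem (truncatedQM_subset d hα)
  -- Passing to a real α strictly below the infimum also covers an empty domain, where the infimum
  -- is ⊤.
  · obtain ⟨α, haα, hα⟩ := EReal.lt_iff_exists_real_btwn.1 ha
    obtain ⟨d, hd⟩ := exists_mem_truncatedQM (sub_mem_of_lt_stateInf hC hArch hf hα)
    exact haα.trans_le ((le_sSup (Set.mem_image_of_mem Real.toEReal hd)).trans (le_iSup (sosBound C f) d))

end StateBounds

end

theorem corollary2 {n : ℕ} (C : Set (NCStatePoly n)) (hC : ∀ c ∈ C, IsSelfAdjoint c)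
    (hArch : IsArchimedeanConstraintSet C) (f : StatePoly n) (hf : IsSelfAdjoint f) :
    Monotone (sosBound C f) ∧
      Filter.Tendsto (sosBound C f) Filter.atTop (nhds (stateInf C f)) ∧
      ((stateDomain C).Nonempty → ∃ a : ℝ, stateInf C f = (a : EReal)) := by
  refine ⟨sosBound_mono C f, ?_, fun ⟨p, hp⟩ => ?_⟩
  · rw [← iSup_sosBound hC hArch hf]
    exact tendsto_atTop_iSup (sosBound_mono C f)
  · obtain ⟨α, hα⟩ := exists_sub_mem_of_isSelfAdjoint hC hArch hf
    refine ⟨(stateInf C f).toReal, (EReal.coe_toReal ?_ ?_).symm⟩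
    · exact ((iInf₂_le p hp).trans_lt (EReal.coe_lt_top _)).ne
    · exact ((EReal.bot_lt_coe α).trans_le (le_stateInf_of_sub_mem hα)).ne'
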